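/- Let $I\subset[-\infty,\infty]$ be an interval, let $\partial$ be a cemetery point adjoined to $I$ (as the point at infinity if $I$ is not compact, as an isolated point if $I$ is compact), and let $X=(\Omega,\mathcal F,\mathcal F_t,X_t,\theta_t,\mathbb P_x)$ be a standard process with state space $I$, cemetery $\partial$ and lifetime $\zeta=\inf\{t\ge 0: X_t=\partial\}$; that is, a normal time-homogeneous Markov process with shifts $\theta_t$ for which $\partial$ is a trap, whose filtration is right-continuous and complete with respect to the laws $\mathbb P_\mu=\int\mathbb P_x\,\mu(dx)$, whose paths are almost surely right-continuous on $[0,\infty)$ with left limits in $I$ on $(0,\zeta)$, which has the strong Markov property, and which is quasi-left-continuous on $[0,\zeta)$ (if $T_n$ are stopping times increasing to $T$, then $X_{T_n}\to X_T$ almost surely on $\{T<\zeta\}$). For $A\subset I$ let $\tau_A=\inf\{t>0: X_t\in A\}$ (with $\inf\emptyset=\infty$), and for $x\in I$ write $\tau_x=\tau_{\{x\}}$ and $\tau_x^-=\tau_{I\cap[-\infty,x]}$. Then the following are equivalent: 1. $\mathbb P_z[\tau_x^-<\tau_y]=0$ for all $x,y,z\in I$ with $x<y<z$; 2. $\mathbb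 P_x[\,X_t-X_{t-}<0 \text{ for some } t>0\,]=0$ for every $x\in I$. Here $X_t-X_{t-}<0$ means that both $X_t$ and the left limit $X_{t-}$ lie in $I$ and $X_t<X_{t-}$; a passage to $\partial$ is not a jump. -/

import Mathlib

open MeasureTheory Filter Topology
open scoped NNReal ENNReal

/-- A normal time-homogeneous Markov process
`(Ω, 𝓜, 𝓜_t, X_t, θ_t, P_x)` with state space `E` (a locally compact space with its Borel sets)
and cemetery `∂`. The space `E ∪ {∂}` is `OnePoint E`, and `∂` is `OnePoint.infty`: the point at infinity
if `E` is not compact, an isolated point if `E` is compact. -/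
structure MarkovProcess (Ω : Type*) [m : MeasurableSpace Ω] (E : Type*) [TopologicalSpace E] where
  /-- the filtration `(𝓜_t)` -/
  filtration : Filtration ℝ≥0 m
  /-- the coordinates `X_t` -/
  X : ℝ≥0 → Ω → OnePoint E
  /-- the shift operators -/
  θ : ℝ≥0 → Ω → Ω
  /-- the laws `P_x`, for `x` in `E ∪ {∂}` -/
  P : OnePoint E → Measure Ω
  isProbabilityMeasure : ∀ x, IsProbabilityMeasure (P x)
  /-- `∂` is a trap. -/
  trap : ∀ s t ω, s ≤ t → X s ω = OnePoint.infty → X t ω = OnePoint.infty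
  adapted : ∀ t, Measurable[filtration t, borel (OnePoint E)] (X t)
  shift : ∀ t h ω, X t (θ h ω) = X (t + h) ω
  measurable_P : ∀ (t : ℝ≥0) (B : Set (OnePoint E)), MeasurableSet[borel (OnePoint E)] B →
    Measurable[borel (OnePoint E)] fun x => P x {ω | X t ω ∈ B}
  normal : ∀ x, ∀ᵐ ω ∂P x, X 0 ω = x
  /-- `P_x(X_{t+s} ∈ B | 𝓜_t) = P_{X_t}(X_s ∈ B)`. -/
  markov : ∀ (x : OnePoint E) (s t : ℝ≥0) (B : Set (OnePoint E)) (Λ : Set Ω),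
    MeasurableSet[borel (OnePoint E)] B → MeasurableSet[filtration t] Λ →
    P x (Λ ∩ {ω | X (t + s) ω ∈ B}) = ∫⁻ ω in Λ, P (X t ω) {ω' | X s ω' ∈ B} ∂P x

namespace MarkovProcess

variable {Ω : Type*} [m : MeasurableSpace Ω] {E : Type*} [TopologicalSpace E]

/-- The position at a time in `[0, ∞]`, with `X_∞ = ∂`. -/
noncomputable def stateAt (X : MarkovProcess Ω E) (t : ℝ≥0∞) (ω : Ω) : OnePoint E :=
  if t = ⊤ then OnePoint.infty else X.X t.toNNReal ω

/-- The lifetime `ζ = inf {t ≥ 0 | X_t = ∂}`. -/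
noncomputable def lifetime (X : MarkovProcess Ω E) (ω : Ω) : ℝ≥0∞ :=
  ⨅ (t : ℝ≥0) (_ : X.X t ω = OnePoint.infty), (t : ℝ≥0∞)

/-- The first hitting time `τ_A = inf {t > 0 | X_t ∈ A}` of a set `A ⊆ E`. -/
noncomputable def hittingTime (X : MarkovProcess Ω E) (A : Set E) (ω : Ω) : ℝ≥0∞ :=
  ⨅ (t : ℝ≥0) (_ : 0 < t ∧ ∃ a ∈ A, X.X t ω = (a : OnePoint E)), (t : ℝ≥0∞)

/-- The σ-algebra generated by all the `X_t`. -/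
abbrev generatedSigma (X : MarkovProcess Ω E) : MeasurableSpace Ω :=
  ⨆ t, (borel (OnePoint E)).comap (X.X t)

end MarkovProcess

/-- A standard process: a normal Markov process whose filtration is complete with respect to the
family of laws `P_μ = ∫ P_x μ(dx)` and right-continuous, whose paths are almost surely
right-continuous on `[0, ∞)` with left limits on `(0, ζ)`, and which is strong Markov and
quasi-left-continuous on `[0, ζ)`. -/
structure StandardProcess (Ω : Type*) [m : MeasurableSpace Ω] (E : Type*) [TopologicalSpace E]
    extends MarkovProcess Ω E where
  rightCont_filtration : filtration.IsRightContinuous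
  /-- A set that, for each initial law `μ`, differs from a member of `𝓜_t` by a subset of a
  `P_μ`-null set lies in `𝓜_t`. -/
  complete_filtration : ∀ (t : ℝ≥0) (A : Set Ω),
    (∀ μ : @Measure (OnePoint E) (borel (OnePoint E)), μ Set.univ = 1 →
      ∃ B N : Set Ω, MeasurableSet[filtration t] B ∧
        MeasurableSet[toMarkovProcess.generatedSigma] N ∧
        (A \ B) ∪ (B \ A) ⊆ N ∧
        @lintegral (OnePoint E) (borel (OnePoint E)) μ (fun x => P x N) = 0) →
    MeasurableSet[filtration t] A
  rightCont_paths : ∀ x, ∀ᵐ ω ∂P x, ∀ t,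
    ContinuousWithinAt (fun s => X s ω) (Set.Ici t) t
  leftLimits : ∀ x, ∀ᵐ ω ∂P x, ∀ t : ℝ≥0, 0 < t → (t : ℝ≥0∞) < toMarkovProcess.lifetime ω →
    ∃ y : E, Tendsto (fun s => X s ω) (𝓝[<] t) (𝓝 (y : OnePoint E))
  /-- For a stopping time `T`, the position `X_T` is `𝓜_T`-measurable. -/
  measurable_stateAt : ∀ (T : Ω → ℝ≥0∞) (hT : IsStoppingTime filtration T),
    Measurable[hT.measurableSpace, borel (OnePoint E)]
      fun ω => toMarkovProcess.stateAt (T ω) ω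
  /-- `P_x(X_{T+s} ∈ B | 𝓜_T) = P_{X_T}(X_s ∈ B)` for every stopping time `T`. -/
  strongMarkov : ∀ (x : OnePoint E) (T : Ω → ℝ≥0∞) (hT : IsStoppingTime filtration T)
    (s : ℝ≥0) (B : Set (OnePoint E)) (Λ : Set Ω),
    MeasurableSet[borel (OnePoint E)] B → MeasurableSet[hT.measurableSpace] Λ →
    P x (Λ ∩ {ω | toMarkovProcess.stateAt (T ω + s) ω ∈ B}) =
      ∫⁻ ω in Λ, P (toMarkovProcess.stateAt (T ω) ω) {ω' | X s ω' ∈ B} ∂P x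
  quasiLeftCont : ∀ (T : ℕ → Ω → ℝ≥0∞), (∀ n, IsStoppingTime filtration (T n)) →
    (∀ ω, Monotone fun n => T n ω) →
    ∀ x, ∀ᵐ ω ∂P x, (⨆ n, T n ω) < toMarkovProcess.lifetime ω →
      Tendsto (fun n => toMarkovProcess.stateAt (T n ω) ω) atTop
        (𝓝 (toMarkovProcess.stateAt (⨆ n, T n ω) ω))

namespace StandardProcess

variable {Ω : Type*} [m : MeasurableSpace Ω] {I : Set EReal}

/-- `X_t - X_{t-} < 0`: the position `X_t` and the left limit `X_{t-}` lie in the state space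
(so `t` is not the killing time) and `X_t < X_{t-}`. The inequality is used, not the difference,
since `I` may contain `-∞` or `+∞`. -/
def HasNegativeJumpAt (X : StandardProcess Ω I) (t : ℝ≥0) (ω : Ω) : Prop :=
  ∃ a b : I, Tendsto (fun s => X.X s ω) (𝓝[<] t) (𝓝 (a : OnePoint I)) ∧
    X.X t ω = (b : OnePoint I) ∧ b < a

end StandardProcess

/-! Without negative jumps, a path started above `y` enters the levels at or below `y` at a first
time; there its left limit is at least `y` and its value at most `y`, so the value is `y`. Hence `y`
is hit no later than any level `x < y` is passed (`hittingTime_singleton_le_hittingTime_Iic`).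

Conversely, a jump from `a` down to `b` skips an interval `(p, r)` with `b < p < r < a`. Restarted
shortly before the jump, the path starts above `r` and is soon below `p` without visiting `(p, r)`;
by right continuity it therefore passes `p` strictly before hitting a level `q` in between.
Hypothesis 1 makes this null from every starting point above `q`, and the Markov property at a fixed
restart time transfers nullity to the original path. Times and levels come from countable dense
sets, so countably many null events cover all jumps. -/

namespace MarkovProcess

/-! ### The simple Markov property for the whole future -/

section MarkovProperty

variable {Ω : Type*} [m : MeasurableSpace Ω] {E : Type*} [TopologicalSpace E]

local instance : MeasurableSpace (OnePoint E) := borel (OnePoint E)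

variable (X : MarkovProcess Ω E)

instance (x : OnePoint E) : IsProbabilityMeasure (X.P x) := X.isProbabilityMeasure x

lemma measurable_X (t : ℝ≥0) : Measurable (X.X t) :=
  (X.adapted t).mono (X.filtration.le t) le_rfl

/-- The transition kernel over a time span `s`. -/
noncomputable def transition (s : ℝ≥0) : ProbabilityTheory.Kernel (OnePoint E) (OnePoint E) where
  toFun x := (X.P x).map (X.X s)
  measurable' := by
    refine Measure.measurable_of_measurable_coe _ fun B hB => ?_
    simp only [Measure.map_apply (X.measurable_X s) hB]
    exact X.measurable_P s B hB

lemma transition_apply (s : ℝ≥0) (x : OnePoint E) :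
    X.transition s x = (X.P x).map (X.X s) := rfl

lemma setLIntegral_comp_X_add (x : OnePoint E) (s t : ℝ≥0) {Λ : Set Ω}
    (hΛ : MeasurableSet[X.filtration t] Λ) {g : OnePoint E → ℝ≥0∞} (hg : Measurable g) :
    ∫⁻ ω in Λ, g (X.X (t + s) ω) ∂X.P x =
      ∫⁻ ω in Λ, ∫⁻ y, g y ∂X.transition s (X.X t ω) ∂X.P x := by
  have hΛ' := X.filtration.le t _ hΛ
  have key : ((X.P x).restrict Λ).map (X.X (t + s)) =
      (((X.P x).restrict Λ).map (X.X t)).bind (X.transition s) := by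
    ext B hB
    rw [Measure.map_apply (X.measurable_X _) hB,
      Measure.restrict_apply (X.measurable_X _ hB),
      Measure.bind_apply hB (X.transition s).measurable.aemeasurable,
      lintegral_map ((X.transition s).measurable_coe hB) (X.measurable_X t), Set.inter_comm]
    refine (X.markov x s t B Λ hB hΛ).trans ?_
    simp only [transition_apply, Measure.map_apply (X.measurable_X s) hB]
    rfl
  rw [← lintegral_map hg (X.measurable_X _), key,
    Measure.lintegral_bind (X.transition s).measurable.aemeasurable hg.aemeasurable,
    lintegral_map hg.lintegral_kernel (X.measurable_X t)]

lemma lintegral_comp_X_zero (x : OnePoint E) (g : OnePoint E → ℝ≥0∞) :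
    ∫⁻ ω, g (X.X 0 ω) ∂X.P x = g x := by
  have : (fun ω => g (X.X 0 ω)) =ᵐ[X.P x] fun _ => g x := by
    filter_upwards [X.normal x] with ω hω
    rw [hω]
  rw [lintegral_congr_ae this]
  simp

/-- Finite-dimensional form of the Markov property; the function `g` does not depend on the time
`r` at which the observation starts. -/
lemma exists_setLIntegral_cylinder (B : ℝ≥0 → Set (OnePoint E)) (T : Finset ℝ≥0) :
    (∀ i ∈ T, MeasurableSet (B i)) → ∀ t : ℝ≥0, (∀ i ∈ T, t ≤ i) →
    ∃ g : OnePoint E → ℝ≥0∞, Measurable g ∧ ∀ (r : ℝ≥0) (x : OnePoint E) (Λ : Set Ω),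
      MeasurableSet[X.filtration (r + t)] Λ →
      X.P x (Λ ∩ {ω | ∀ i ∈ T, X.X (r + i) ω ∈ B i}) = ∫⁻ ω in Λ, g (X.X (r + t) ω) ∂X.P x := by
  induction T using Finset.induction_on_min with
  | empty =>
    intro _ t _
    exact ⟨fun _ => 1, measurable_const, fun r x Λ hΛ => by simp⟩
  | insert a T haT ih =>
    intro hB t ht
    obtain ⟨g, hg, hgT⟩ := ih (fun i hi => hB i (Finset.mem_insert_of_mem hi)) a
      fun i hi => (haT i hi).le
    have hBa : MeasurableSet (B a) := hB a (Finset.mem_insert_self a T)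
    have hta : t ≤ a := ht a (Finset.mem_insert_self a T)
    have hg' : Measurable ((B a).indicator g) := hg.indicator hBa
    -- The earliest time `a` is peeled off: the later constraints integrate to `g` at time `r + a`,
    -- and the transition over `a - t` carries this back to `r + t`.
    refine ⟨fun y => ∫⁻ z, (B a).indicator g z ∂X.transition (a - t) y,
      hg'.lintegral_kernel, fun r x Λ hΛ => ?_⟩
    have hΛ' : MeasurableSet[X.filtration (r + a)] Λ :=
      X.filtration.mono (add_le_add_right hta r) _ hΛ
    have hX : MeasurableSet[X.filtration (r + a)] (X.X (r + a) ⁻¹' B a) := X.adapted (r + a) hBa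
    have hset : Λ ∩ {ω | ∀ i ∈ insert a T, X.X (r + i) ω ∈ B i} =
        (Λ ∩ X.X (r + a) ⁻¹' B a) ∩ {ω | ∀ i ∈ T, X.X (r + i) ω ∈ B i} := by
      ext ω
      simp [and_assoc]
    have hsum : r + t + (a - t) = r + a := by
      rw [add_assoc, add_tsub_cancel_of_le hta]
    rw [hset, hgT r x _ (hΛ'.inter hX), ← X.setLIntegral_comp_X_add x (a - t) (r + t) hΛ hg', hsum,
      Set.inter_comm, ← setLIntegral_indicator (X.filtration.le _ _ hX)]
    rfl

lemma generatedSigma_le : X.generatedSigma ≤ m :=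
  iSup_le fun t => (X.measurable_X t).comap_le

lemma measurable_shift (t : ℝ≥0) : Measurable[m, X.generatedSigma] (X.θ t) := by
  refine measurable_iff_comap_le.2 ?_
  rw [MeasurableSpace.comap_iSup]
  refine iSup_le fun s => ?_
  rw [MeasurableSpace.comap_comp]
  have : X.X s ∘ X.θ t = X.X (s + t) := funext fun ω => X.shift s t ω
  rw [this]
  exact (X.measurable_X _).comap_le

/-- The simple Markov property for events of the whole future, together with the measurability of
the laws in the starting point. -/
theorem markov_shift {S : Set Ω} (hS : MeasurableSet[X.generatedSigma] S) :
    Measurable (fun x => X.P x S) ∧ ∀ (x : OnePoint E) (t : ℝ≥0) (Λ : Set Ω),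
      MeasurableSet[X.filtration t] Λ →
      X.P x (Λ ∩ X.θ t ⁻¹' S) = ∫⁻ ω in Λ, X.P (X.X t ω) S ∂X.P x := by
  have hgen : X.generatedSigma = MeasurableSpace.generateFrom
      (piiUnionInter (fun t => {s | MeasurableSet[(borel (OnePoint E)).comap (X.X t)] s})
        Set.univ) := by
    refine Eq.trans ?_ (generateFrom_piiUnionInter_measurableSet
      (fun t => (borel (OnePoint E)).comap (X.X t)) Set.univ).symm
    simp [generatedSigma]
  refine MeasurableSpace.induction_on_inter
    (C := fun S _ => Measurable (fun x => X.P x S) ∧ ∀ (x : OnePoint E) (t : ℝ≥0) (Λ : Set Ω),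
      MeasurableSet[X.filtration t] Λ →
      X.P x (Λ ∩ X.θ t ⁻¹' S) = ∫⁻ ω in Λ, X.P (X.X t ω) S ∂X.P x) hgen
    (isPiSystem_piiUnionInter _ (fun t =>
      @MeasurableSpace.isPiSystem_measurableSet _ ((borel (OnePoint E)).comap (X.X t))) _)
    ?_ ?_ ?_ ?_ S hS
  · simp
  · rintro S ⟨T, -, f, hf, rfl⟩
    choose! B hB hBf using hf
    -- One `g` serves twice: `r = 0` and normality identify it with the probability of the cylinder,
    -- and `r = t` evaluates the shifted cylinder.
    obtain ⟨g, hg, hgT⟩ := X.exists_setLIntegral_cylinder B T hB 0 fun _ _ => zero_le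
    have hset : (⋂ i ∈ T, f i) = {ω | ∀ i ∈ T, X.X i ω ∈ B i} := by
      ext ω
      simp only [Set.mem_iInter, Set.mem_ofPred_eq]
      exact forall₂_congr fun i hi => by rw [← hBf i hi]; rfl
    have hP : ∀ x, X.P x (⋂ i ∈ T, f i) = g x := fun x => by
      have := hgT 0 x Set.univ MeasurableSet.univ
      simpa [hset, X.lintegral_comp_X_zero x g] using this
    simp only [hP]
    refine ⟨hg, fun x t Λ hΛ => ?_⟩
    have := hgT t x Λ (by rwa [add_zero])
    simp only [add_zero] at this
    rw [← this, hset]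
    congr 2
    ext ω
    simp only [Set.mem_preimage, Set.mem_ofPred_eq, X.shift, add_comm]
  · rintro S hS ⟨hmeas, hmk⟩
    have hSm := X.generatedSigma_le _ hS
    have hc : ∀ x, X.P x Sᶜ = 1 - X.P x S := fun x => prob_compl_eq_one_sub hSm
    simp only [hc]
    refine ⟨measurable_const.sub hmeas, fun x t Λ hΛ => ?_⟩
    have hθ : MeasurableSet (X.θ t ⁻¹' S) := X.measurable_shift t hS
    have hint : ∫⁻ ω in Λ, X.P (X.X t ω) S ∂X.P x ≠ ⊤ := by
      rw [← hmk x t Λ hΛ]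
      exact measure_ne_top _ _
    rw [lintegral_sub (f := fun _ => 1) (g := fun ω => X.P (X.X t ω) S)
        (hmeas.comp (X.measurable_X t)) hint (ae_of_all _ fun ω => prob_le_one),
      ← hmk x t Λ hΛ, Set.preimage_compl, ← Set.sdiff_eq, ← Set.sdiff_self_inter,
      measure_sdiff Set.inter_subset_left
        ((X.filtration.le t _ hΛ).inter hθ).nullMeasurableSet (measure_ne_top _ _)]
    simp
  · rintro f hd hf hC
    have hfm : ∀ i, MeasurableSet (f i) := fun i => X.generatedSigma_le _ (hf i)
    have hP : ∀ x, X.P x (⋃ i, f i) = ∑' i, X.P x (f i) := fun x => measure_iUnion hd hfm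
    simp only [hP]
    refine ⟨Measurable.tsum fun i => (hC i).1, fun x t Λ hΛ => ?_⟩
    rw [lintegral_tsum (f := fun i ω => X.P (X.X t ω) (f i)) fun i =>
        ((hC i).1.comp (X.measurable_X t)).aemeasurable,
      Set.preimage_iUnion, Set.inter_iUnion, measure_iUnion]
    · exact tsum_congr fun i => (hC i).2 x t Λ hΛ
    · exact fun i j hij => ((hd hij).preimage _).mono Set.inter_subset_right Set.inter_subset_right
    · exact fun i => (X.filtration.le t _ hΛ).inter (X.measurable_shift t (hf i))

end MarkovProperty

/-! ### Regularity of paths -/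

section Paths

variable {Ω : Type*} [m : MeasurableSpace Ω] {E : Type*} [TopologicalSpace E]
  (X : MarkovProcess Ω E)

lemma hittingTime_le {A : Set E} {ω : Ω} {t : ℝ≥0} {a : E} (ht : 0 < t) (ha : a ∈ A)
    (h : X.X t ω = a) : X.hittingTime A ω ≤ t :=
  iInf₂_le t ⟨ht, a, ha, h⟩

lemma exists_X_eq_coe_of_le {ω : Ω} {s t : ℝ≥0} (hst : s ≤ t)
    (h : X.X t ω ≠ OnePoint.infty) : ∃ a : E, X.X s ω = a := by
  obtain ⟨a, ha⟩ := OnePoint.ne_infty_iff_exists.1 fun hs => h (X.trap s t ω hst hs)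
  exact ⟨a, ha.symm⟩

/-- A right-continuous path stays for a while in an open set which it visits. -/
lemma exists_Ico_subset_of_isOpen {ω : Ω} {t : ℝ≥0}
    (hω : ContinuousWithinAt (fun s => X.X s ω) (Set.Ici t) t) {U : Set E} (hU : IsOpen U)
    {a : E} (ha : a ∈ U) (hX : X.X t ω = a) :
    ∃ v, t < v ∧ ∀ s, t ≤ s → s < v → ∃ b ∈ U, X.X s ω = b := by
  have hmem : (↑) '' U ∈ 𝓝 (X.X t ω) :=
    (OnePoint.isOpenEmbedding_coe.isOpenMap U hU).mem_nhds ⟨a, ha, hX.symm⟩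
  obtain ⟨v, hv, hsub⟩ := mem_nhdsGE_iff_exists_Ico_subset.1 (hω hmem)
  refine ⟨v, hv, fun s hs hsv => ?_⟩
  obtain ⟨b, hb, hbs⟩ := hsub ⟨hs, hsv⟩
  exact ⟨b, hb, hbs.symm⟩

lemma exists_Ioo_subset_of_tendsto {ω : Ω} {t : ℝ≥0} (ht : 0 < t) {U : Set E} (hU : IsOpen U)
    {a : E} (ha : a ∈ U) (hX : Tendsto (fun s => X.X s ω) (𝓝[<] t) (𝓝 (a : OnePoint E))) :
    ∃ u, u < t ∧ ∀ s, u < s → s < t → ∃ b ∈ U, X.X s ω = b := by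
  have hmem : (↑) '' U ∈ 𝓝 (a : OnePoint E) :=
    (OnePoint.isOpenEmbedding_coe.isOpenMap U hU).mem_nhds ⟨a, ha, rfl⟩
  obtain ⟨u, hu, hsub⟩ := (mem_nhdsLT_iff_exists_Ioo_subset' ht).1 (hX hmem)
  refine ⟨u, hu, fun s hs hst => ?_⟩
  obtain ⟨b, hb, hbs⟩ := hsub ⟨hs, hst⟩
  exact ⟨b, hb, hbs.symm⟩

/-- Right continuity keeps the path in `E` for a while after `t`, and the trap property excludes `∂`
before `t`; this makes the inequality strict, as the left-limit axiom requires. -/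
lemma lt_lifetime_of_X_eq_coe {ω : Ω} {t : ℝ≥0}
    (hω : ContinuousWithinAt (fun s => X.X s ω) (Set.Ici t) t) {a : E} (hX : X.X t ω = a) :
    (t : ℝ≥0∞) < X.lifetime ω := by
  obtain ⟨v, htv, hv⟩ := X.exists_Ico_subset_of_isOpen hω isOpen_univ (Set.mem_univ a) hX
  refine (ENNReal.coe_lt_coe.2 htv).trans_le (le_iInf₂ fun r hr => ENNReal.coe_le_coe.2 ?_)
  by_contra! hrv
  rcases le_total t r with h | h
  · obtain ⟨b, -, hb⟩ := hv r h hrv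
    exact OnePoint.coe_ne_infty b (hb.symm.trans hr)
  · exact OnePoint.coe_ne_infty a (hX.symm.trans (X.trap r t ω h hr))

end Paths

end MarkovProcess

/-! ### Hitting levels and skipping intervals -/

namespace StandardProcess

variable {Ω : Type*} [m : MeasurableSpace Ω] {I : Set EReal} (X : StandardProcess Ω I)

/-- A path without negative jumps which starts above `y` hits `y` before it gets below `x < y`. -/
lemma hittingTime_singleton_le_hittingTime_Iic [I.OrdConnected] {x y z : I} (hxy : x < y)
    (hyz : y < z) {ω : Ω} (h0 : X.X 0 ω = z)
    (hr : ∀ t, ContinuousWithinAt (fun s => X.X s ω) (Set.Ici t) t)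
    (hl : ∀ t : ℝ≥0, 0 < t → (t : ℝ≥0∞) < X.lifetime ω →
      ∃ y : I, Tendsto (fun s => X.X s ω) (𝓝[<] t) (𝓝 (y : OnePoint I)))
    (hjump : ∀ t : ℝ≥0, 0 < t → ¬ X.HasNegativeJumpAt t ω) :
    X.hittingTime {y} ω ≤ X.hittingTime (Set.Iic x) ω := by
  refine le_iInf₂ fun t ⟨ht, a, ha, hat⟩ => ?_
  have halive : X.X t ω ≠ OnePoint.infty := hat ▸ OnePoint.coe_ne_infty a
  let S : Set ℝ≥0 := {r | ∃ b : I, b ≤ y ∧ X.X r ω = b}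
  have htS : t ∈ S := ⟨a, le_trans ha hxy.le, hat⟩
  set s := sInf S with hs
  have hst : s ≤ t := csInf_le' htS
  have hbefore : ∀ r < s, ∃ c : I, y < c ∧ X.X r ω = c := fun r hrs => by
    obtain ⟨c, hc⟩ := X.exists_X_eq_coe_of_le (hrs.le.trans hst) halive
    refine ⟨c, ?_, hc⟩
    by_contra! hcy
    exact notMem_of_lt_csInf' hrs ⟨c, hcy, hc⟩
  -- The infimum is attained: from a value above `y`, right continuity would keep the path above `y`
  -- just after `s`.
  have hsS : s ∈ S := by
    obtain ⟨c, hc⟩ := X.exists_X_eq_coe_of_le hst halive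
    refine ⟨c, ?_, hc⟩
    by_contra! hcy
    obtain ⟨v, hsv, hv⟩ := X.exists_Ico_subset_of_isOpen (hr s) isOpen_Ioi hcy hc
    obtain ⟨r, ⟨d, hdy, hd⟩, hrv⟩ := exists_lt_of_csInf_lt ⟨t, htS⟩ hsv
    obtain ⟨e, he, hre⟩ := hv r (csInf_le' ⟨d, hdy, hd⟩) hrv
    have : d = e := OnePoint.coe_injective (hd.symm.trans hre)
    exact absurd he (by simpa [← this] using hdy)
  obtain ⟨b, hby, hb⟩ := hsS
  have hspos : 0 < s := by
    refine pos_iff_ne_zero.2 fun h => ?_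
    rw [h, h0] at hb
    exact absurd hyz (not_lt.2 (OnePoint.coe_injective hb ▸ hby))
  obtain ⟨l, hlim⟩ := hl s hspos
    ((ENNReal.coe_le_coe.2 hst).trans_lt (X.lt_lifetime_of_X_eq_coe (hr t) hat))
  have hyl : y ≤ l := by
    by_contra! hly
    obtain ⟨u, hus, hu⟩ := X.exists_Ioo_subset_of_tendsto hspos isOpen_Iio hly hlim
    obtain ⟨r, hur, hrs⟩ := exists_between hus
    obtain ⟨c, hcy, hc⟩ := hbefore r hrs
    obtain ⟨d, hdy, hd⟩ := hu r hur hrs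
    have : c = d := OnePoint.coe_injective (hc.symm.trans hd)
    exact absurd hdy (by simpa [← this] using hcy.le)
  rcases hby.eq_or_lt with rfl | hlt
  · exact (X.hittingTime_le hspos (Set.mem_singleton b) hb).trans (ENNReal.coe_le_coe.2 hst)
  · exact absurd ⟨l, b, hlim, hb, hlt.trans_le hyl⟩ (hjump s hspos)

/-- The paths which, observed at the times in `D`, get below `p` at time `w` without having visited
the interval `(p, r)`. -/
def skipEvent (D : Set ℝ≥0) (w : ℝ≥0) (p r : I) : Set Ω :=
  {ω | X.X w ω ∈ ((↑) '' Set.Iio p : Set (OnePoint I)) ∧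
    ∀ s ∈ D, s ≤ w → X.X s ω ∉ ((↑) '' Set.Ioo p r : Set (OnePoint I))}

/-- Countability of `D` gives measurability in the σ-algebra of the coordinates, so that
`markov_shift` applies. -/
lemma measurableSet_skipEvent [I.OrdConnected] {D : Set ℝ≥0} (hD : D.Countable) (w : ℝ≥0)
    (p r : I) : MeasurableSet[X.generatedSigma] (X.skipEvent D w p r) := by
  have hmeas : ∀ (s : ℝ≥0) (U : Set I), IsOpen U →
      MeasurableSet[X.generatedSigma] {ω | X.X s ω ∈ ((↑) '' U : Set (OnePoint I))} :=
    fun s U hU => le_iSup (fun t => (borel (OnePoint I)).comap (X.X t)) s _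
      ⟨_, MeasurableSpace.measurableSet_generateFrom
        (OnePoint.isOpenEmbedding_coe.isOpenMap U hU), rfl⟩
  have hset : X.skipEvent D w p r = {ω | X.X w ω ∈ ((↑) '' Set.Iio p : Set (OnePoint I))} ∩
      ⋂ s ∈ D, ⋂ _ : s ≤ w, {ω | X.X s ω ∈ ((↑) '' Set.Ioo p r : Set (OnePoint I))}ᶜ := by
    ext ω
    simp [skipEvent]
  rw [hset]
  exact (hmeas w _ isOpen_Iio).inter (MeasurableSet.biInter hD fun s _ =>
    MeasurableSet.iInter fun _ => (hmeas s _ isOpen_Ioo).compl)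

lemma hittingTime_lt_of_mem_skipEvent [I.OrdConnected] {D : Set ℝ≥0} (hD : Dense D) {w : ℝ≥0}
    (hw : 0 < w) {p q r : I} (hpq : p < q) (hqr : q < r) {ω : Ω}
    (hr : ∀ t, ContinuousWithinAt (fun s => X.X s ω) (Set.Ici t) t)
    (hω : ω ∈ X.skipEvent D w p r) :
    X.hittingTime (Set.Iic p) ω < X.hittingTime {q} ω := by
  obtain ⟨⟨a, ha, haw⟩, hskip⟩ := hω
  -- The path stays below `q` on `[w, v)`, which yields the strict inequality.
  obtain ⟨v, hwv, hv⟩ := X.exists_Ico_subset_of_isOpen (hr w) isOpen_Iio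
    (show a ∈ Set.Iio q from lt_trans ha hpq) haw.symm
  refine (X.hittingTime_le hw (Set.Iio_subset_Iic_self ha) haw.symm).trans_lt
    ((ENNReal.coe_lt_coe.2 hwv).trans_le (le_iInf₂ fun s hs => ENNReal.coe_le_coe.2 ?_))
  obtain ⟨-, q', hq', hqs⟩ := hs
  obtain rfl : q' = q := hq'
  by_contra! hsv
  rcases le_or_gt w s with hws | hsw
  · obtain ⟨b, hb, hbs⟩ := hv s hws hsv
    exact absurd hb (by simp [← OnePoint.coe_injective (hqs.symm.trans hbs)])
  -- A visit to `q` before `w` would keep the path in `(p, r)` long enough to be seen at a time of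
  -- `D`.
  · obtain ⟨v', hsv', hv'⟩ := X.exists_Ico_subset_of_isOpen (hr s) isOpen_Ioo
      (show q' ∈ Set.Ioo p r from ⟨hpq, hqr⟩) hqs
    obtain ⟨d, hd, hsd, hdv⟩ := hD.exists_between (lt_min hsv' hsw)
    obtain ⟨b, hb, hbd⟩ := hv' d hsd.le (hdv.trans_le (min_le_left _ _))
    exact hskip d hd (hdv.le.trans (min_le_right _ _)) ⟨b, hb, hbd.symm⟩

/-- Near a negative jump a right-continuous path skips an interval, along times and levels taken
from given dense sets. -/
lemma exists_shift_mem_skipEvent [I.OrdConnected] {D : Set ℝ≥0} (hD : Dense D) {Q : Set I}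
    (hQ : Dense Q) {ω : Ω} (hr : ∀ t, ContinuousWithinAt (fun s => X.X s ω) (Set.Ici t) t)
    {t : ℝ≥0} (ht : 0 < t) (hjump : X.HasNegativeJumpAt t ω) :
    ∃ u ∈ D, ∃ w ∈ D, ∃ p ∈ Q, ∃ q ∈ Q, ∃ r ∈ Q, 0 < w ∧ p < q ∧ q < r ∧
      X.X u ω ∈ ((↑) '' Set.Ioi q : Set (OnePoint I)) ∧ X.θ u ω ∈ X.skipEvent D w p r := by
  obtain ⟨a, b, hlim, hb, hba⟩ := hjump
  obtain ⟨p, hp, hbp, hpa⟩ := hQ.exists_between hba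
  obtain ⟨q, hq, hpq, hqa⟩ := hQ.exists_between hpa
  obtain ⟨r, hrQ, hqr, hra⟩ := hQ.exists_between hqa
  obtain ⟨u₀, hu₀, hleft⟩ := X.exists_Ioo_subset_of_tendsto ht isOpen_Ioi hra hlim
  obtain ⟨u, hu, hu₀u, hut⟩ := hD.exists_between hu₀
  obtain ⟨v, htv, hright⟩ := X.exists_Ico_subset_of_isOpen (hr t) isOpen_Iio hbp hb
  -- `w` is measured from the restart at `u`, so `w + u` falls just after the jump.
  obtain ⟨w, hw, htw, hwv⟩ := hD.exists_between
    (tsub_lt_tsub_right_of_le hut.le htv : t - u < v - u)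
  have htw' : t < w + u := tsub_lt_iff_right hut.le |>.1 htw
  have hwv' : w + u < v := lt_tsub_iff_right.1 hwv
  obtain ⟨c, hc, hcu⟩ := hleft u hu₀u hut
  refine ⟨u, hu, w, hw, p, hp, q, hq, r, hrQ, pos_of_gt htw, hpq, hqr,
    ⟨c, lt_trans hqr hc, hcu.symm⟩, ?_, ?_⟩
  · obtain ⟨d, hd, hdw⟩ := hright _ htw'.le hwv'
    exact ⟨d, hd, by rw [X.shift, hdw]⟩
  · rintro s - hsw ⟨e, ⟨hpe, her⟩, hes⟩
    rw [X.shift] at hes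
    rcases lt_or_ge (s + u) t with h | h
    · obtain ⟨d, hd, hds⟩ := hleft (s + u) (hu₀u.trans_le le_add_self) h
      exact absurd hd (by simp [← OnePoint.coe_injective (hes.trans hds), her.le])
    · obtain ⟨d, hd, hds⟩ := hright (s + u) h ((add_le_add_left hsw u).trans_lt hwv')
      exact absurd hd (by simp [← OnePoint.coe_injective (hes.trans hds), hpe.le])

/-- Conditioning at time `u` reduces this to starting points `z > q`, where the skip event lies, up
to a null set, in the null event of `h`. -/
lemma measure_shift_preimage_skipEvent [I.OrdConnected]
    (h : ∀ x y z : I, x < y → y < z →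
      X.P (z : OnePoint I) {ω | X.hittingTime (Set.Iic x) ω < X.hittingTime {y} ω} = 0)
    {D : Set ℝ≥0} (hD : Dense D) (hDc : D.Countable) (u : ℝ≥0) {w : ℝ≥0} (hw : 0 < w) {p q r : I}
    (hpq : p < q) (hqr : q < r) (x : OnePoint I) :
    X.P x ({ω | X.X u ω ∈ ((↑) '' Set.Ioi q : Set (OnePoint I))} ∩
      X.θ u ⁻¹' X.skipEvent D w p r) = 0 := by
  have hΛ : MeasurableSet[X.filtration u]
      {ω | X.X u ω ∈ ((↑) '' Set.Ioi q : Set (OnePoint I))} :=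
    X.adapted u (MeasurableSpace.measurableSet_generateFrom
      (OnePoint.isOpenEmbedding_coe.isOpenMap _ isOpen_Ioi))
  rw [(X.markov_shift (X.measurableSet_skipEvent hDc w p r)).2 x u _ hΛ]
  refine setLIntegral_eq_zero (X.filtration.le u _ hΛ) ?_
  rintro ω ⟨z, hqz, hz⟩
  simp only [← hz, Pi.zero_apply]
  have hae : ∀ᵐ ω ∂X.P (z : OnePoint I), ω ∉ X.skipEvent D w p r := by
    have hnull : ∀ᵐ ω ∂X.P (z : OnePoint I),
        ¬ X.hittingTime (Set.Iic p) ω < X.hittingTime {q} ω := by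
      rw [ae_iff]
      simpa only [not_not] using h p q z hpq hqz
    filter_upwards [hnull, X.rightCont_paths z] with ω hω hr hmem
    exact hω (X.hittingTime_lt_of_mem_skipEvent hD hw hpq hqr hr hmem)
  simpa [ae_iff] using hae

end StandardProcess

theorem mainTheorem12 {Ω : Type*} [MeasurableSpace Ω] (I : Set EReal) (hI : I.OrdConnected)
    (X : StandardProcess Ω I) :
    (∀ x y z : I, x < y → y < z →
      X.P (z : OnePoint I) {ω | X.hittingTime (Set.Iic x) ω < X.hittingTime {y} ω} = 0) ↔
    (∀ x : I, X.P (x : OnePoint I) {ω | ∃ t : ℝ≥0, 0 < t ∧ X.HasNegativeJumpAt t ω} = 0) := by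
  refine ⟨fun h x => ?_, fun h x y z hxy hyz => ?_⟩
  · obtain ⟨D, hDc, hD⟩ := TopologicalSpace.exists_countable_dense ℝ≥0
    obtain ⟨Q, hQc, hQ⟩ := TopologicalSpace.exists_countable_dense I
    have hskip : ∀ᵐ ω ∂X.P (x : OnePoint I), ∀ u ∈ D, ∀ w ∈ D, ∀ p ∈ Q, ∀ q ∈ Q, ∀ r ∈ Q,
        0 < w → p < q → q < r →
        ¬ (X.X u ω ∈ ((↑) '' Set.Ioi q : Set (OnePoint I)) ∧ X.θ u ω ∈ X.skipEvent D w p r) := by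
      simp only [ae_ball_iff hDc, ae_ball_iff hQc, eventually_imp_distrib_left]
      intro u _ w _ p _ q _ r _ hw hpq hqr
      rw [ae_iff]
      simp only [not_not]
      exact X.measure_shift_preimage_skipEvent h hD hDc u hw hpq hqr x
    have hae : ∀ᵐ ω ∂X.P (x : OnePoint I), ¬ ∃ t : ℝ≥0, 0 < t ∧ X.HasNegativeJumpAt t ω := by
      filter_upwards [hskip, X.rightCont_paths x] with ω hω hr
      rintro ⟨t, ht, hjump⟩
      obtain ⟨u, hu, w, hw, p, hp, q, hq, r, hrQ, hw0, hpq, hqr, hmem⟩ :=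
        X.exists_shift_mem_skipEvent hD hQ hr ht hjump
      exact hω u hu w hw p hp q hq r hrQ hw0 hpq hqr hmem
    simpa only [ae_iff, not_not] using hae
  · have hnull : ∀ᵐ ω ∂X.P (z : OnePoint I), ¬ ∃ t : ℝ≥0, 0 < t ∧ X.HasNegativeJumpAt t ω := by
      simpa only [ae_iff, not_not] using h z
    have hae : ∀ᵐ ω ∂X.P (z : OnePoint I),
        ¬ X.hittingTime (Set.Iic x) ω < X.hittingTime {y} ω := by
      filter_upwards [hnull, X.normal z, X.rightCont_paths z, X.leftLimits z] with ω hω h0 hr hl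
      exact not_lt.2 (X.hittingTime_singleton_le_hittingTime_Iic hxy hyz h0 hr hl
        fun t ht hj => hω ⟨t, ht, hj⟩)
    simpa only [ae_iff, not_not] using hae
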